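/- All topological groups are assumed Hausdorff. A topological abelian group $G$ is *precompact* if for every neighbourhood $U$ of $0$ there is a finite set $F\subseteq G$ with $G=F+U$. A *quotient group* of $G$ is a topological group $G/H$ with $H$ a closed subgroup of $G$ ($H=0$ allowed). The density $d(X)$ of a topological space $X$ is the least cardinality of a dense subset of $X$. Write $\mathfrak c=2^{\omega}$, let $\mathfrak c^+$ be its cardinal successor, for a cardinal $\tau$ let $\ln\tau$ be the least cardinal $\mu$ with $2^\mu\ge\tau$, and let $2^{<\mathfrak c}=\sup\{2^\mu:\mu<\mathfrak c\}$. **Theorem.** There is a least cardinal $\mathfrak m$ such that every infinite precompact abelian group has an infinite quotient group of density $\le\mathfrak m$, and $$\ln(\mathfrak c^+)\le\mathfrak m .$$ In particular, if $2^{<\mathfrak c}=\mathfrak c$, then $\mathfrak m=\mathfrak c$. -/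

import Mathlib

open Cardinal Topology
open scoped Pointwise

universe u

namespace PrecompactQuotients

/-- A topological (additive) group is precompact if for every neighbourhood `U` of `0` there is a
finite set `F` with `G = F + U`. -/
def IsPrecompact (G : Type u) [AddGroup G] [TopologicalSpace G] : Prop :=
  ∀ U ∈ 𝓝 (0 : G), ∃ F : Set G, F.Finite ∧ F + U = Set.univ

/-- The density `d(X)`: the least cardinality of a dense subset of `X`. -/
noncomputable def density (X : Type u) [TopologicalSpace X] : Cardinal.{u} :=
  sInf {κ : Cardinal.{u} | ∃ D : Set X, Dense D ∧ #D = κ}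

/-- `ln τ` is the least cardinal `μ` with `τ ≤ 2 ^ μ`. -/
noncomputable def ln (τ : Cardinal.{u}) : Cardinal.{u} :=
  sInf {μ : Cardinal.{u} | τ ≤ 2 ^ μ}

/-- The cardinals `κ` such that every infinite Hausdorff precompact abelian group `G` has an
infinite Hausdorff quotient group (a quotient `G ⧸ H` by a closed subgroup `H`, where `H = 0` is
allowed) of density at most `κ`. -/
def quotientDensityBounds : Set Cardinal.{u} :=
  {κ : Cardinal.{u} | ∀ (G : Type u) [AddCommGroup G] [TopologicalSpace G]
    [IsTopologicalAddGroup G] [T2Space G], Infinite G → IsPrecompact G →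
      ∃ H : AddSubgroup G, IsClosed (H : Set G) ∧ Infinite (G ⧸ H) ∧ density (G ⧸ H) ≤ κ}

/-- The cardinal `𝔪`: the least element of `quotientDensityBounds`. -/
noncomputable def leastQuotientDensity : Cardinal.{u} :=
  sInf quotientDensityBounds.{u}

end PrecompactQuotients

namespace PrecompactQuotients

/-! Upper bound 𝔠: countably many neighbourhoods of 0 keep a countable infinite set injective modulo
a closed subgroup `H`, and precompactness then codes `G ⧸ H` by a sequence of finite choices. Lower
bound: let G be free abelian on at most 𝔠 generators `X`, with an injective character e into the
circle. Give it the topology of the characters v ↦ e(r • v), where r : X → ℤ depends on finitely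
many of 2^𝔠 independent two-valued coordinates. If H is closed and proper, some such r ≠ 0 has e(r •
v) = 0 on H, hence r • v = 0 there by injectivity. Then r times any coordinate indicator also kills
H, giving 2^𝔠 continuous characters of G/H. These are determined on a dense set, so 𝔠 < 𝔠^d with d
the density, which forces 𝔠 < 2^d. -/

theorem exists_dense_mk_eq_density (X : Type u) [TopologicalSpace X] :
    ∃ D : Set X, Dense D ∧ #D = density X :=
  csInf_mem (s := {κ : Cardinal.{u} | ∃ D : Set X, Dense D ∧ #D = κ})
    ⟨_, Set.univ, dense_univ, rfl⟩

theorem density_le_mk (X : Type u) [TopologicalSpace X] : density X ≤ #X :=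
  csInf_le' ⟨Set.univ, dense_univ, mk_univ⟩

/-! ### Upper bound: quotients of size at most 𝔠 -/

/-- In a topological group, countably many neighbourhoods of `0` contain a closed subgroup which
contains the intersection of the sets `U n - U n` for a sequence of neighbourhoods `U n` of `0`. -/
theorem exists_isClosed_addSubgroup_subset_nhds {G : Type u} [AddCommGroup G] [TopologicalSpace G]
    [IsTopologicalAddGroup G] (W : ℕ → Set G) (hW : ∀ n, W n ∈ 𝓝 (0 : G)) :
    ∃ (U : ℕ → Set G) (H : AddSubgroup G), (∀ n, U n ∈ 𝓝 (0 : G)) ∧ IsClosed (H : Set G) ∧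
      (∀ n, (H : Set G) ⊆ W n) ∧
      ∀ x, (∀ n, ∃ v ∈ U n, ∃ w ∈ U n, x = v - w) → x ∈ H := by
  have half : ∀ (n : ℕ) (S : {S : Set G // S ∈ 𝓝 (0 : G)}),
      ∃ V : {S : Set G // S ∈ 𝓝 (0 : G)}, ∀ v ∈ V.1, ∀ w ∈ V.1, v - w ∈ S.1 ∩ W n := by
    intro n S
    obtain ⟨V, hV, h⟩ := exists_nhds_half_neg (Filter.inter_mem S.2 (hW n))
    exact ⟨⟨V, hV⟩, h⟩
  choose next hnext using half
  let U : ℕ → {S : Set G // S ∈ 𝓝 (0 : G)} := fun n => Nat.rec ⟨Set.univ, Filter.univ_mem⟩ next n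
  have hU : ∀ n, ∀ v ∈ (U (n + 1)).1, ∀ w ∈ (U (n + 1)).1, v - w ∈ (U n).1 ∩ W n :=
    fun n => hnext n (U n)
  have h0 : ∀ n, (0 : G) ∈ (U n).1 := fun n => mem_of_mem_nhds (U n).2
  let H : AddSubgroup G := AddSubgroup.ofSub {x | ∀ n, x ∈ (U n).1} ⟨0, h0⟩
    fun x hx y hy n => by
      rw [← sub_eq_add_neg]
      exact (hU n x (hx (n + 1)) y (hy (n + 1))).1
  have hH : ∀ x, x ∈ H ↔ ∀ n, x ∈ (U n).1 := fun x => Iff.rfl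
  refine ⟨fun n => (U n).1, H, fun n => (U n).2, ?_, ?_, ?_⟩
  · refine isClosed_of_closure_subset fun x hx => (hH x).2 fun n => ?_
    have hmem : {y | y - x ∈ (U (n + 1)).1} ∈ 𝓝 x := by
      have : Filter.Tendsto (fun y => y - x) (𝓝 x) (𝓝 0) := by
        have h : Continuous fun y : G => y - x := by fun_prop
        simpa using h.tendsto x
      exact this (U (n + 1)).2
    obtain ⟨y, hy, hyH⟩ := mem_closure_iff_nhds.1 hx _ hmem
    have := (hU n y ((hH y).1 hyH (n + 1)) (y - x) hy).1
    simpa using this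
  · intro n x hx
    simpa using (hU n x ((hH x).1 hx (n + 1)) 0 (h0 (n + 1))).2
  · intro x hx
    refine (hH x).2 fun n => ?_
    obtain ⟨v, hv, w, hw, rfl⟩ := hx (n + 1)
    exact (hU n v hv w hw).1

theorem IsPrecompact.exists_isClosed_infinite_quotient_mk_le {G : Type u} [AddCommGroup G]
    [TopologicalSpace G] [IsTopologicalAddGroup G] [T2Space G] [Infinite G]
    (hG : IsPrecompact G) :
    ∃ H : AddSubgroup G, IsClosed (H : Set G) ∧ Infinite (G ⧸ H) ∧ #(G ⧸ H) ≤ 𝔠 := by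
  let e := Infinite.natEmbedding G
  -- `n` codes a pair (i, j); `W n` omits the difference of the i-th and j-th points, so these stay
  -- distinct modulo `H`.
  let W : ℕ → Set G := fun n =>
    {x | n.unpair.1 ≠ n.unpair.2 → x ≠ -e n.unpair.1 + e n.unpair.2}
  have hW : ∀ n, W n ∈ 𝓝 (0 : G) := by
    intro n
    by_cases h : n.unpair.1 = n.unpair.2
    · simp [W, h]
    · have : (0 : G) ≠ -e n.unpair.1 + e n.unpair.2 := by
        intro h0
        exact h (e.injective (neg_add_eq_zero.1 h0.symm))
      filter_upwards [isOpen_ne.mem_nhds this] with x hx _ using hx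
  obtain ⟨U, H, hU, hcl, hHW, hH⟩ := exists_isClosed_addSubgroup_subset_nhds W hW
  refine ⟨H, hcl, ?_, ?_⟩
  · refine Infinite.of_injective (fun n : ℕ => (e n : G ⧸ H)) fun i j hij => ?_
    by_contra hne
    have := hHW (Nat.pair i j) (QuotientAddGroup.eq.1 hij)
    simp [W, hne] at this
  · choose F hF hFU using fun n => hG (U n) (hU n)
    have hx : ∀ (x : G) (n : ℕ), ∃ f : F n, x - f ∈ U n := by
      intro x n
      obtain ⟨f, hf, v, hv, rfl⟩ := Set.mem_add.1 (hFU n ▸ Set.mem_univ x)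
      exact ⟨⟨f, hf⟩, by simpa using hv⟩
    choose f hf using hx
    have hcount : ∀ n, ∃ c : F n → ℕ, Function.Injective c := by
      intro n
      have := (hF n).countable.to_subtype
      exact exists_injective_nat _
    choose c hc using hcount
    -- Representatives with the same centre at every stage differ by an element of each `U n - U n`,
    -- hence of `H`.
    have hinj : Function.Injective (fun (q : G ⧸ H) (n : ℕ) => c n (f q.out n)) := by
      intro q r hqr
      have key : ∀ n, f q.out n = f r.out n := fun n => hc n (congrFun hqr n)
      have : -q.out + r.out ∈ H := by
        refine hH _ fun n => ⟨_, hf r.out n, _, hf q.out n, ?_⟩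
        rw [key n]
        abel
      have := QuotientAddGroup.eq.2 this
      simpa using this
    have := lift_mk_le_lift_mk_of_injective hinj
    simpa using this

theorem continuum_mem_quotientDensityBounds :
    (𝔠 : Cardinal.{u}) ∈ quotientDensityBounds.{u} := by
  intro G _ _ _ _ _ hG
  obtain ⟨H, hcl, hinf, hle⟩ := hG.exists_isClosed_infinite_quotient_mk_le
  exact ⟨H, hcl, hinf, (density_le_mk _).trans hle⟩

/-! ### Counting circle-valued maps by density -/

theorem mk_continuousMap_le (X : Type u) (Y : Type) [TopologicalSpace X] [TopologicalSpace Y]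
    [T2Space Y] : #C(X, Y) ≤ lift.{u} #Y ^ density X := by
  obtain ⟨D, hD, hcard⟩ := exists_dense_mk_eq_density X
  rw [← hcard]
  have hinj : Function.Injective (fun (f : C(X, Y)) (d : D) => f d) := by
    intro f g hfg
    refine DFunLike.coe_injective (f.continuous.ext_on hD g.continuous fun x hx => ?_)
    exact congrFun hfg ⟨x, hx⟩
  have := mk_le_of_injective hinj
  simpa using this

theorem mk_unitAddCircle_le : #UnitAddCircle ≤ 𝔠 :=
  (mk_le_of_surjective QuotientAddGroup.mk_surjective).trans_eq mk_real

theorem continuum_lt_two_power_density {X : Type u} [TopologicalSpace X]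
    (h : 𝔠 < #C(X, UnitAddCircle)) : 𝔠 < (2 : Cardinal.{u}) ^ density X := by
  have h1 : 𝔠 < (𝔠 : Cardinal.{u}) ^ density X := by
    refine h.trans_le ((mk_continuousMap_le X UnitAddCircle).trans ?_)
    refine power_le_power_right ?_
    simpa using mk_unitAddCircle_le
  -- Finite density is impossible, since 𝔠^ℵ₀ = 𝔠.
  rcases lt_or_ge (density X) ℵ₀ with hd | hd
  · exact absurd h1 (not_lt.2 
      ((power_le_power_left continuum_ne_zero hd.le).trans_eq continuum_power_aleph0))
  · rwa [← two_power_aleph0, ← power_mul, aleph0_mul_eq hd] at h1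

/-! ### Duality for closed subgroups of tori -/

theorem mFourier_apply_eq_toCircle {d : Type*} [Fintype d] (m : d → ℤ) (x : UnitAddTorus d) :
    UnitAddTorus.mFourier m x = AddCircle.toCircle (∑ i, m i • x i) := by
  classical
  have h : ∀ s : Finset d, ((AddCircle.toCircle (∑ i ∈ s, m i • x i) : Circle) : ℂ) =
      ∏ i ∈ s, fourier (m i) (x i) := by
    intro s
    induction s using Finset.induction_on with
    | empty => simp
    | insert a s ha ih =>
      rw [Finset.sum_insert ha, Finset.prod_insert ha, AddCircle.toCircle_add, Circle.coe_mul, ih,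
        fourier_apply]
  exact (h Finset.univ).symm

/-- Characters of a torus separate points from closed subgroups. -/
theorem exists_character_vanishing_on_closed_addSubgroup {d : Type*} [Fintype d]
    (C : AddSubgroup (UnitAddTorus d)) (hC : IsClosed (C : Set (UnitAddTorus d)))
    {y : UnitAddTorus d} (hy : y ∉ C) :
    ∃ m : d → ℤ, (∀ c ∈ C, ∑ i, m i • c i = 0) ∧ ∑ i, m i • y i ≠ 0 := by
  by_contra! hcon
  have : CompactSpace C := isCompact_iff_compactSpace.1 hC.isCompact
  let _ : MeasurableSpace C := borel C
  have : BorelSpace C := ⟨rfl⟩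
  let μ : MeasureTheory.Measure C := MeasureTheory.Measure.addHaar
  have hint : ∀ (y : UnitAddTorus d) (f : C(UnitAddTorus d, ℂ)),
      MeasureTheory.Integrable (fun c : C => f (y + c)) μ := fun y f =>
    (Continuous.integrable_of_hasCompactSupport (by fun_prop)
      (HasCompactSupport.of_compactSpace _))
  have hcont : ∀ y : UnitAddTorus d,
      Continuous fun f : C(UnitAddTorus d, ℂ) => ∫ c : C, f (y + c) ∂μ := by
    intro y
    refine continuous_iff_continuousAt.2 fun f => ?_
    refine (LipschitzWith.of_dist_le_mul (K := (μ Set.univ).toNNReal)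
      fun f g => ?_).continuous.continuousAt
    rw [dist_eq_norm, ← MeasureTheory.integral_sub (hint y f) (hint y g), mul_comm]
    refine MeasureTheory.norm_integral_le_of_norm_le_const (Filter.Eventually.of_forall fun c => ?_)
    rw [← dist_eq_norm]
    exact ContinuousMap.dist_apply_le_dist _
  -- Functions with equal Haar averages over `C` and `y + C`. If the claim fails, `S` contains every
  -- character, hence everything by density, contradicting Urysohn.
  let S : Submodule ℂ C(UnitAddTorus d, ℂ) :=
    { carrier := {f | ∫ c : C, f (y + c) ∂μ = ∫ c : C, f (0 + c) ∂μ}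
      add_mem' := by
        intro f g hf hg
        simp only [Set.mem_ofPred_eq, ContinuousMap.add_apply] at hf hg ⊢
        rw [MeasureTheory.integral_add (hint y f) (hint y g),
          MeasureTheory.integral_add (hint 0 f) (hint 0 g), hf, hg]
      zero_mem' := by simp
      smul_mem' := by
        intro a f hf
        simp only [Set.mem_ofPred_eq, ContinuousMap.smul_apply] at hf ⊢
        rw [MeasureTheory.integral_smul, MeasureTheory.integral_smul, hf] }
  have hSclosed : IsClosed (S : Set C(UnitAddTorus d, ℂ)) := isClosed_eq (hcont y) (hcont 0)
  have hmem : Set.range (UnitAddTorus.mFourier (d := d)) ⊆ S := by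
    rintro _ ⟨m, rfl⟩
    change ∫ c : C, UnitAddTorus.mFourier m (y + c) ∂μ = ∫ c : C, UnitAddTorus.mFourier m (0 + c) ∂μ
    have hadd : ∀ a b : UnitAddTorus d, UnitAddTorus.mFourier m (a + b) =
        UnitAddTorus.mFourier m a * UnitAddTorus.mFourier m b := by
      intro a b
      simp only [mFourier_apply_eq_toCircle, Pi.add_apply, smul_add, Finset.sum_add_distrib,
        AddCircle.toCircle_add, Circle.coe_mul]
    by_cases hm : ∀ c ∈ C, ∑ i, m i • c i = 0
    · have h1 : UnitAddTorus.mFourier m y = 1 := by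
        rw [mFourier_apply_eq_toCircle, hcon m hm]
        simp
      simp_rw [hadd y, h1, one_mul, zero_add]
    · push Not at hm
      obtain ⟨c₀, hc₀, hne⟩ := hm
      have hne1 : UnitAddTorus.mFourier m c₀ ≠ 1 := by
        rw [mFourier_apply_eq_toCircle]
        intro h
        apply hne
        apply AddCircle.injective_toCircle one_ne_zero
        rw [AddCircle.toCircle_zero]
        exact Circle.coe_injective (h.trans Circle.coe_one.symm)
      have hz : ∫ c : C, UnitAddTorus.mFourier m (c : UnitAddTorus d) ∂μ = 0 := by
        have h := MeasureTheory.integral_add_left_eq_self (μ := μ)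
          (fun c : C => UnitAddTorus.mFourier m (c : UnitAddTorus d)) ⟨c₀, hc₀⟩
        simp only [AddSubgroup.coe_add, hadd] at h
        rw [MeasureTheory.integral_const_mul] at h
        have : (UnitAddTorus.mFourier m c₀ - 1) *
            ∫ c : C, UnitAddTorus.mFourier m (c : UnitAddTorus d) ∂μ = 0 := by
          rw [sub_mul, h, one_mul, sub_self]
        exact (mul_eq_zero.1 this).resolve_left (sub_ne_zero.2 hne1)
      simp_rw [hadd, MeasureTheory.integral_const_mul, hz, mul_zero]
  have hS : ∀ f, f ∈ S := by
    have h := (Submodule.topologicalClosure_minimal _ (Submodule.span_le.2 hmem) hSclosed)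
    rw [UnitAddTorus.span_mFourier_closure_eq_top] at h
    exact fun f => h trivial
  have hdisj : Disjoint (C : Set (UnitAddTorus d)) ((fun c => y + c) '' C) := by
    rw [Set.disjoint_left]
    rintro _ hx ⟨c, hc, rfl⟩
    exact hy ((AddSubgroup.add_mem_cancel_right C hc).1 hx)
  obtain ⟨f, hf0, hf1, -⟩ := exists_continuous_zero_one_of_isClosed hC
    ((Homeomorph.addLeft y).isClosedMap _ hC) hdisj
  have h := hS ⟨fun x => (f x : ℂ), by fun_prop⟩
  change ∫ c : C, ((f (y + c) : ℝ) : ℂ) ∂μ = ∫ c : C, ((f (0 + c) : ℝ) : ℂ) ∂μ at h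
  have e1 : ∀ c : C, f (y + c) = 1 := fun c => hf1 ⟨c, c.2, rfl⟩
  have e0 : ∀ c : C, f (0 + c) = 0 := fun c => hf0 (by simp)
  simp only [e1, e0] at h
  rw [MeasureTheory.integral_const] at h
  have hμ : μ = 0 := by simpa [MeasureTheory.measureReal_eq_zero_iff] using h
  exact NeZero.ne μ hμ

/-! ### Independent coordinates and the injective character -/

/-- The coordinates of Hausdorff's independent family on
`Finset ℝ × Finset (Finset ℝ)`, indexed by sets of reals. -/
noncomputable def indepCoord (i : Set ℝ) (x : Finset ℝ × Finset (Finset ℝ)) : Prop :=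
  open Classical in {a ∈ x.1 | a ∈ i} ∈ x.2

/-- A finite set of reals separating the members of `s` gives them distinct traces; list the traces
of those satisfying `p`. -/
theorem exists_indepCoord_iff (s : Finset (Set ℝ)) (p : Set ℝ → Prop) :
    ∃ x, ∀ i ∈ s, (indepCoord i x ↔ p i) := by
  classical
  have hsep : ∀ i j : Set ℝ, ∃ a : ℝ, i ≠ j → ¬ (a ∈ i ↔ a ∈ j) := by
    intro i j
    by_cases h : i = j
    · exact ⟨0, fun h' => absurd h h'⟩
    · by_contra! hcon
      exact h (Set.ext fun a => (hcon a).2)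
  choose a ha using hsep
  let F : Finset ℝ := (s ×ˢ s).image fun q => a q.1 q.2
  refine ⟨(F, {i ∈ s | p i}.image fun i => {b ∈ F | b ∈ i}), fun i hi => ?_⟩
  simp only [indepCoord, Finset.mem_image, Finset.mem_filter]
  constructor
  · rintro ⟨j, ⟨hj, hpj⟩, hij⟩
    suffices j = i from this ▸ hpj
    by_contra hne
    have hF : a j i ∈ F := Finset.mem_image.2 ⟨(j, i), Finset.mem_product.2 ⟨hj, hi⟩, rfl⟩
    have := Finset.ext_iff.1 hij (a j i)
    simp only [Finset.mem_filter, hF, true_and] at this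
    exact ha j i hne this
  · exact fun hp => ⟨i, ⟨hi, hp⟩, rfl⟩

theorem mk_finset_real_prod_le : #(Finset ℝ × Finset (Finset ℝ)) ≤ 𝔠 := by
  simp [mk_finset_of_infinite, mk_real]

/-- Send the generators to distinct elements other than 1 of a Hamel basis containing 1: no nonzero
integer combination of them is an integer. -/
theorem exists_injective_addMonoidHom_unitAddCircle {X : Type u} (hX : #X ≤ 𝔠) :
    ∃ f : (X →₀ ℤ) →+ UnitAddCircle, Function.Injective f := by
  have hli : LinearIndepOn ℚ id ({1} : Set ℝ) := LinearIndepOn.singleton one_ne_zero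
  let b := Module.Basis.extend hli
  let B := hli.extend (Set.subset_univ _)
  have h1 : (1 : ℝ) ∈ B := hli.subset_extend _ rfl
  have hB : #B = 𝔠 := (Module.Basis.mk_eq_rank'' b).trans Real.rank_rat_real
  have hB' : #{c : B // c ≠ ⟨1, h1⟩} = 𝔠 := by
    have : Infinite B := by
      rw [infinite_iff, hB]
      exact aleph0_le_continuum
    refine (mk_compl_of_infinite {⟨1, h1⟩} ?_).trans hB
    rw [mk_singleton]
    exact one_lt_aleph0.trans_le (aleph0_le_mk B)
  obtain ⟨g⟩ : Nonempty (X ↪ {c : B // c ≠ ⟨1, h1⟩}) := by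
    rw [← lift_mk_le', hB']
    simpa using hX
  let w : Option X → B := fun o => o.elim ⟨1, h1⟩ fun x => (g x).1
  have hw : Function.Injective w := by
    rintro (_ | x) (_ | y) h
    · rfl
    · exact absurd h.symm (g y).2
    · exact absurd h (g x).2
    · exact congrArg some (g.injective (Subtype.ext h))
  let v : X → ℝ := fun x => ((g x).1 : ℝ)
  have hlin : LinearIndependent ℚ (fun o => Option.casesOn' o (1 : ℝ) v) := by
    have hbw : (fun o => Option.casesOn' o (1 : ℝ) v) = b ∘ w := by
      funext o
      rcases o with _ | x <;> simp [w, v, b]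
    rw [hbw]
    exact b.linearIndependent.comp w hw
  obtain ⟨hv, h1v⟩ := linearIndependent_option'.1 hlin
  have hvZ : LinearIndependent ℤ v := hv.restrict_scalars (by
    intro m n h
    simpa using h)
  refine ⟨(QuotientAddGroup.mk' _).comp (Finsupp.linearCombination ℤ v).toAddMonoidHom, ?_⟩
  refine (injective_iff_map_eq_zero _).2 fun a ha => ?_
  obtain ⟨n, hn⟩ := AddSubgroup.mem_zmultiples_iff.1 ((QuotientAddGroup.eq_zero_iff _).1 ha)
  have hspan : ((n : ℚ) • (1 : ℝ)) ∈ Submodule.span ℚ (Set.range v) := by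
    have : Finsupp.linearCombination ℤ v a ∈ Submodule.span ℤ (Set.range v) :=
      (Finsupp.mem_span_range_iff_exists_finsupp).2 ⟨a, rfl⟩
    have h2 := Submodule.span_subset_span ℤ ℚ _ this
    have h3 : (n : ℚ) • (1 : ℝ) = Finsupp.linearCombination ℤ v a := by
      rw [← LinearMap.toAddMonoidHom_coe, ← hn]
      simp [Rat.smul_def]
    rw [h3]
    exact h2
  have hn0 : n = 0 := by
    by_contra hne
    exact h1v ((Submodule.smul_mem_iff _ (by exact_mod_cast hne)).1 hspan)
  rw [hn0, zero_smul] at hn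
  exact linearIndependent_iff.1 hvZ a hn.symm

/-! ### Topologies induced by characters -/

theorem isPrecompact_of_isInducing {G : Type u} [AddCommGroup G] [TopologicalSpace G] {K : Type*}
    [AddCommGroup K] [TopologicalSpace K] [IsTopologicalAddGroup K] [CompactSpace K]
    (f : G →+ K) (hf : IsInducing f) : IsPrecompact G := by
  intro U hU
  rw [hf.nhds_eq_comap, map_zero] at hU
  obtain ⟨W, hW, hWU⟩ := hU
  obtain ⟨V, hV, hVW⟩ := exists_nhds_half_neg hW
  obtain ⟨t, -, ht⟩ := isCompact_univ.elim_nhds_subcover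
    (fun k : K => {z : K | z - k ∈ V}) fun k _ => by
    have h : Continuous fun z : K => z - k := by fun_prop
    exact h.continuousAt.preimage_mem_nhds (by simpa using hV)
  -- Centres of the cover of `K` may lie outside the image, so each is replaced by a nearby image
  -- point if there is one.
  have hpick : ∀ k : K, ∃ g : G, ∀ v : G, f v - k ∈ V → f g - k ∈ V := by
    intro k
    by_cases h : ∃ g : G, f g - k ∈ V
    · exact h.imp fun g hg _ _ => hg
    · exact ⟨0, fun v hv => absurd ⟨v, hv⟩ h⟩
  choose g hg using hpick
  refine ⟨g '' t, t.finite_toSet.image g, Set.eq_univ_of_forall fun v => ?_⟩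
  obtain ⟨k, hk, hvk⟩ := Set.mem_iUnion₂.1 (ht (Set.mem_univ (f v)))
  refine Set.mem_add.2 ⟨g k, ⟨k, hk, rfl⟩, v - g k, hWU ?_, add_sub_cancel _ _⟩
  have := hVW _ hvk _ (hg k v hvk)
  simpa using this

/-- If the topology of `G` is induced by a homomorphism to a power of the circle, then integer
combinations of the coordinates separate points from closed subgroups. -/
theorem exists_sum_zsmul_vanishing_on_closed_addSubgroup {G ι : Type*} [AddCommGroup G]
    [TopologicalSpace G] (f : G →+ (ι → UnitAddCircle)) (hf : IsInducing f) (H : AddSubgroup G)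
    (hH : IsClosed (H : Set G)) {y : G} (hy : y ∉ H) :
    ∃ (s : Finset ι) (m : s → ℤ), (∀ h ∈ H, ∑ i, m i • f h i = 0) ∧ ∑ i, m i • f y i ≠ 0 := by
  obtain ⟨W, hW, hWH⟩ := hf.isOpen_iff.1 hH.isOpen_compl
  have hyW : f y ∈ W := by
    have : y ∈ f ⁻¹' W := hWH ▸ hy
    exact this
  obtain ⟨s, u, hu, hsu⟩ := isOpen_pi_iff.1 hW _ hyW
  let ρ : G →+ UnitAddTorus s :=
    { toFun := fun v i => f v i
      map_zero' := by ext; simp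
      map_add' := by intros; ext; simp }
  obtain ⟨m, hm, hmy⟩ := exists_character_vanishing_on_closed_addSubgroup
    (H.map ρ).topologicalClosure (AddSubgroup.isClosed_topologicalClosure _) (y := ρ y) (by
      intro hmem
      have hopen : IsOpen (Set.univ.pi fun i : s => u i) :=
        isOpen_set_pi Set.finite_univ fun i _ => (hu i i.2).1
      obtain ⟨z, hz, v, hv, rfl⟩ := mem_closure_iff.1 hmem _ hopen fun i _ => (hu i i.2).2
      have : v ∈ f ⁻¹' W := hsu fun i hi => hz ⟨i, hi⟩ trivial
      rw [hWH] at this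
      exact this hv)
  exact ⟨s, m, fun h hh => hm _ (AddSubgroup.le_topologicalClosure _ ⟨h, hh, rfl⟩), hmy⟩

/-! ### The group without small quotients -/

/-- Functions depending on finitely many of the coordinates `coord i`. -/
def DependsOnFinitelyMany {X I : Type*} (coord : I → X → Prop) (r : X → ℤ) : Prop :=
  ∃ s : Finset I, ∀ x y, (∀ i ∈ s, coord i x ↔ coord i y) → r x = r y

theorem DependsOnFinitelyMany.sum_zsmul {X I ι : Type*} {coord : I → X → Prop} (t : Finset ι)
    (m : ι → ℤ) (r : ι → X → ℤ) (hr : ∀ k ∈ t, DependsOnFinitelyMany coord (r k)) :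
    DependsOnFinitelyMany coord (∑ k ∈ t, m k • r k) := by
  classical
  induction t using Finset.induction_on with
  | empty => exact ⟨∅, fun x y _ => by simp⟩
  | insert a t ha ih =>
    obtain ⟨s, hs⟩ := ih fun k hk => hr k (Finset.mem_insert_of_mem hk)
    obtain ⟨s', hs'⟩ := hr a (Finset.mem_insert_self _ _)
    refine ⟨s ∪ s', fun x y hxy => ?_⟩
    rw [Finset.sum_insert ha, Pi.add_apply, Pi.add_apply,
      hs x y fun i hi => hxy i (Finset.mem_union_left _ hi)]
    simp [hs' x y fun i hi => hxy i (Finset.mem_union_right _ hi)]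

/-- The indicator function of the coordinate `coord i`. -/
noncomputable def coordIndicator {X I : Type*} (coord : I → X → Prop) (i : I) (x : X) : ℤ :=
  open Classical in if coord i x then 1 else 0

theorem DependsOnFinitelyMany.coordIndicator_mul {X I : Type*} {coord : I → X → Prop} {r : X → ℤ}
    (hr : DependsOnFinitelyMany coord r) (i : I) :
    DependsOnFinitelyMany coord (coordIndicator coord i * r) := by
  classical
  obtain ⟨s, hs⟩ := hr
  refine ⟨insert i s, fun x y hxy => ?_⟩
  simp [coordIndicator, hxy i (Finset.mem_insert_self _ _),
    hs x y fun j hj => hxy j (Finset.mem_insert_of_mem hj)]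

/-- The homomorphism `v ↦ (r ↦ e (r • v))`, for `r` depending on finitely many coordinates. -/
noncomputable def coordEval {X I : Type*} (coord : I → X → Prop) (e : (X →₀ ℤ) →+ UnitAddCircle) :
    (X →₀ ℤ) →+ ({r : X → ℤ // DependsOnFinitelyMany coord r} → UnitAddCircle) where
  toFun v r := e (r.1 • v)
  map_zero' := by ext; simp
  map_add' _ _ := by ext; simp

theorem coordEval_injective {X I : Type*} (coord : I → X → Prop) {e : (X →₀ ℤ) →+ UnitAddCircle}
    (he : Function.Injective e) : Function.Injective (coordEval coord e) := by
  intro v w h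
  have h1 : DependsOnFinitelyMany coord 1 := ⟨∅, fun _ _ _ => rfl⟩
  simpa [coordEval] using he (congrFun h ⟨1, h1⟩)

/-- For independent coordinates, a proper closed subgroup of `X →₀ ℤ` is annihilated by as many
characters as there are coordinates. -/
theorem mk_continuousMap_quotient_ge {X : Type u} {I : Type} [Infinite I] (coord : I → X → Prop)
    (hcoord : ∀ (s : Finset I) (p : I → Prop), ∃ x, ∀ i ∈ s, (coord i x ↔ p i))
    {e : (X →₀ ℤ) →+ UnitAddCircle} (he : Function.Injective e) [TopologicalSpace (X →₀ ℤ)]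
    (hind : IsInducing (coordEval coord e)) (H : AddSubgroup (X →₀ ℤ))
    (hH : IsClosed (H : Set (X →₀ ℤ))) (hne : H ≠ ⊤) :
    lift.{u} #I ≤ #C((X →₀ ℤ) ⧸ H, UnitAddCircle) := by
  classical
  obtain ⟨y, -, hy⟩ := SetLike.exists_of_lt (lt_top_iff_ne_top.2 hne)
  obtain ⟨t, m, hm, hmy⟩ := exists_sum_zsmul_vanishing_on_closed_addSubgroup _ hind H hH hy
  let r : X → ℤ := ∑ k : t, m k • k.1.1
  have hr : DependsOnFinitelyMany coord r :=
    DependsOnFinitelyMany.sum_zsmul _ _ _ fun k _ => k.1.2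
  have hsum : ∀ v, ∑ k : t, m k • coordEval coord e v k = e (r • v) := by
    intro v
    simp only [r, Finset.sum_smul, map_sum, coordEval, AddMonoidHom.coe_mk, ZeroHom.coe_mk,
      smul_assoc, map_zsmul]
  simp only [hsum] at hm hmy
  have hrH : ∀ v ∈ H, r • v = 0 := fun v hv => (map_eq_zero_iff e he).1 (hm v hv)
  have hr0 : r ≠ 0 := by
    intro h
    simp [h] at hmy
  obtain ⟨x₀, hx₀⟩ := Function.ne_iff.1 hr0
  obtain ⟨s, hs⟩ := hr
  -- Excluding the finite support `s` of `r` lets a coordinate vary while `r` keeps its value at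
  -- `x₀`.
  let χ : {i : I // i ∉ s} → C((X →₀ ℤ) ⧸ H, UnitAddCircle) := fun i =>
    ⟨QuotientAddGroup.lift H (e.comp
      (DistribSMul.toAddMonoidHom (X →₀ ℤ) (coordIndicator coord i.1 * r))) (by
        intro v hv
        simp [AddMonoidHom.mem_ker, mul_smul, hrH v hv]),
      (continuous_quot_lift _ ((continuous_apply
        (⟨_, DependsOnFinitelyMany.coordIndicator_mul ⟨s, hs⟩ i.1⟩ :
          {r : X → ℤ // DependsOnFinitelyMany coord r})).comp hind.continuous))⟩
  have hχ : Function.Injective χ := by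
    intro i j hij
    by_contra hne
    have hne : j.1 ≠ i.1 := fun h => hne (Subtype.ext h.symm)
    obtain ⟨x, hx⟩ := hcoord (insert i.1 (insert j.1 s))
      (fun k => if k = i.1 then True else if k = j.1 then False else coord k x₀)
    have hxi : coord i.1 x := by simpa using hx i.1 (by simp)
    have hxj : ¬ coord j.1 x := by simpa [hne] using hx j.1 (by simp)
    have hrx : r x = r x₀ := by
      refine hs x x₀ fun k hk => ?_
      have hki : k ≠ i.1 := fun h => i.2 (h ▸ hk)
      have hkj : k ≠ j.1 := fun h => j.2 (h ▸ hk)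
      simpa [hki, hkj] using hx k (by simp [hk])
    have h1 : (coordIndicator coord i.1 * r) • Finsupp.single x (1 : ℤ) =
        (coordIndicator coord j.1 * r) • Finsupp.single x (1 : ℤ) :=
      he (DFunLike.congr_fun hij (Finsupp.single x (1 : ℤ) : (X →₀ ℤ) ⧸ H))
    have h2 := DFunLike.congr_fun h1 x
    simp [coordIndicator, hxi, hxj, hrx] at h2
    exact hx₀ h2
  have hcard : #{i : I // i ∉ s} = #I := mk_compl_finset_of_infinite s
  have := lift_mk_le_lift_mk_of_injective hχ
  rw [hcard] at this
  simpa using this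

/-- There is an infinite precompact abelian group all of whose infinite quotients have a density
`d` with `𝔠 < 2 ^ d`. -/
theorem exists_isPrecompact_continuum_lt_two_power_density :
    ∃ (G : Type u) (_ : AddCommGroup G) (_ : TopologicalSpace G) (_ : IsTopologicalAddGroup G)
      (_ : T2Space G), Infinite G ∧ IsPrecompact G ∧ ∀ H : AddSubgroup G, IsClosed (H : Set G) →
        Infinite (G ⧸ H) → 𝔠 < (2 : Cardinal.{u}) ^ density (G ⧸ H) := by
  let X := ULift.{u} (Finset ℝ × Finset (Finset ℝ))
  have hX : #X ≤ 𝔠 := by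
    rw [mk_uLift, ← lift_continuum.{u, 0}]
    exact lift_le.2 mk_finset_real_prod_le
  obtain ⟨e, he⟩ := exists_injective_addMonoidHom_unitAddCircle hX
  let coord : Set ℝ → X → Prop := fun i x => indepCoord i x.down
  have hcoord : ∀ (s : Finset (Set ℝ)) (p : Set ℝ → Prop), ∃ x, ∀ i ∈ s, (coord i x ↔ p i) :=
    fun s p => (exists_indepCoord_iff s p).imp' ULift.up fun x hx => hx
  let τ : TopologicalSpace (X →₀ ℤ) := TopologicalSpace.induced (coordEval coord e) inferInstance
  have hind : IsInducing (coordEval coord e) := ⟨rfl⟩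
  have hT2 : T2Space (X →₀ ℤ) :=
    T2Space.of_injective_continuous (coordEval_injective coord he) hind.continuous
  refine ⟨X →₀ ℤ, inferInstance, τ, hind.topologicalAddGroup _, hT2, inferInstance,
    isPrecompact_of_isInducing _ hind, fun H hH hinf => continuum_lt_two_power_density ?_⟩
  have hne : H ≠ ⊤ := by
    rintro rfl
    exact not_finite ((X →₀ ℤ) ⧸ (⊤ : AddSubgroup (X →₀ ℤ)))
  refine lt_of_lt_of_le ?_ (mk_continuousMap_quotient_ge coord hcoord he hind H hH hne)
  rw [← lift_continuum.{u, 0}, lift_lt, mk_set, mk_real]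
  exact cantor _

theorem ln_succ_continuum_le_of_mem {κ : Cardinal.{u}} (hκ : κ ∈ quotientDensityBounds.{u}) :
    ln (Order.succ 𝔠) ≤ κ := by
  obtain ⟨G, _, _, _, _, hinf, hpre, hG⟩ :=
    exists_isPrecompact_continuum_lt_two_power_density.{u}
  obtain ⟨H, hH, hHinf, hle⟩ := hκ G hinf hpre
  have hmem : density (G ⧸ H) ∈ {μ : Cardinal.{u} | Order.succ 𝔠 ≤ 2 ^ μ} :=
    Order.succ_le_of_lt (hG H hH hHinf)
  exact (csInf_le' hmem).trans hle

theorem continuum_le_ln_succ_continuum (h : (2 : Cardinal.{u}) ^< 𝔠 = 𝔠) :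
    (𝔠 : Cardinal.{u}) ≤ ln (Order.succ 𝔠) := by
  refine le_csInf ⟨𝔠, Order.succ_le_of_lt (cantor 𝔠)⟩ fun μ hμ => ?_
  by_contra! hlt
  exact (Order.lt_succ 𝔠).not_ge (hμ.trans ((le_powerlt 2 hlt).trans_eq h))

end PrecompactQuotients

theorem mainTheorem2 :
    PrecompactQuotients.leastQuotientDensity.{u} ∈ PrecompactQuotients.quotientDensityBounds.{u} ∧
    PrecompactQuotients.ln (Order.succ (𝔠 : Cardinal.{u})) ≤
        PrecompactQuotients.leastQuotientDensity.{u} ∧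
      ((2 : Cardinal.{u}) ^< 𝔠 = 𝔠 →
        PrecompactQuotients.leastQuotientDensity.{u} = 𝔠) := by
  have hmem : PrecompactQuotients.leastQuotientDensity.{u} ∈
      PrecompactQuotients.quotientDensityBounds.{u} :=
    csInf_mem ⟨_, PrecompactQuotients.continuum_mem_quotientDensityBounds⟩
  have hln := PrecompactQuotients.ln_succ_continuum_le_of_mem hmem
  refine ⟨hmem, hln, fun h => le_antisymm ?_ ?_⟩
  · exact csInf_le' PrecompactQuotients.continuum_mem_quotientDensityBounds
  · exact (PrecompactQuotients.continuum_le_ln_succ_continuum h).trans hln
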